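/- All graphs are finite and simple. For graphs $H$ and $G$, let $\mathcal N(H,G)$ denote the number of (not necessarily induced) subgraphs of $G$ that are isomorphic to $H$, and let $\mathcal N(H_1,\dots,H_k;G)=\sum_{i=1}^k\mathcal N(H_i,G)$. Let $\mathrm{ex}(n,(H_1,\dots,H_k),F)$ denote the largest value of $\mathcal N(H_1,\dots,H_k;G)$ over all $n$-vertex graphs $G$ that do not contain $F$ as a (not necessarily induced) subgraph. Let $T_2(n)$ be the balanced complete bipartite graph on $n$ vertices, with classes of sizes $\lfloor n/2\rfloor$ and $\lceil n/2\rceil$. Consider the following six graphs on five vertices: $M$, consisting of two independent edges and an isolated vertex; $M'$, the disjoint union of a path on three vertices and an edge; $C_4'$, obtained from the cycle $C_4$ by adding a new vertex joined to exactly one vertex of the cycle; the path $P_5$ on five vertices; the complete bipartite graph $K_{2,3}$; and the cycle $C_5$. Let $k\ge 2$ and let $\mathcal T=(H_1,\dots,H_k)$ be a $k$-tuple each of whose entries is one of $M,M',C_4',P_5,K_{2,3},C_5$, where $C_5$ occurs at most once (in particular, $\mathcal T$ may be any $k$-tuple of distinct graphs from this list). Then for every integer $n\ge 0$, $$\mathrm{ex}(n,\mathcal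 T,K_3)=\mathcal N(\mathcal T;T_2(n)).$$ -/

import Mathlib

/-- `𝓝(H₁, …, Hₖ; G)`: the total number of copies (subgraphs of `G` isomorphic to `H i`,
isolated vertices included) of the graphs `H i` in `G`, summed over `i`. -/
noncomputable def totalCopies {k n : ℕ} {V : Fin k → Type} (H : ∀ i, SimpleGraph (V i))
    (G : SimpleGraph (Fin n)) : ℕ :=
  ∑ i, G.copyCount (H i)

open scoped Classical in
/-- `ex(n, (H₁, …, Hₖ), F)`: the largest value of `𝓝(H₁, …, Hₖ; G)` over all `n`-vertex graphs
`G` that contain no (not necessarily induced) copy of `F`. -/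
noncomputable def genEx {k : ℕ} {V : Fin k → Type} {W : Type} (n : ℕ)
    (H : ∀ i, SimpleGraph (V i)) (F : SimpleGraph W) : ℕ :=
  (Finset.univ.filter fun G : SimpleGraph (Fin n) => F.Free G).sup fun G => totalCopies H G

/-- `M`: two independent edges and an isolated vertex. -/
def graphM : SimpleGraph (Fin 5) :=
  SimpleGraph.fromEdgeSet {s(0, 1), s(2, 3)}

/-- `M'`: a path on three vertices and an edge disjoint from it. -/
def graphM' : SimpleGraph (Fin 5) :=
  SimpleGraph.fromEdgeSet {s(0, 1), s(1, 2), s(3, 4)}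

/-- `C₄'`: the four-cycle `0123` with a further vertex `4` joined to `0`. -/
def graphC4' : SimpleGraph (Fin 5) :=
  SimpleGraph.fromEdgeSet {s(0, 1), s(1, 2), s(2, 3), s(3, 0), s(0, 4)}

/-- `P₅`: the path on five vertices. -/
def graphP5 : SimpleGraph (Fin 5) :=
  SimpleGraph.pathGraph 5

/-- `K_{2,3}`, with vertex classes `{0, 1}` and `{2, 3, 4}`. -/
def graphK23 : SimpleGraph (Fin 5) :=
  (completeBipartiteGraph (Fin 2) (Fin 3)).comap (finSumFinEquiv (m := 2) (n := 3)).symm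

/-- `C₅`: the cycle on five vertices. -/
def graphC5 : SimpleGraph (Fin 5) :=
  SimpleGraph.cycleGraph 5

/-! Everything is compared with `graphM`. Write M, K23, C5 for the numbers of copies in a
triangle-free graph G on n vertices, and e(·) for numbers of edges.

Fix a labelled copy of `graphM` in G: edges f0f1 and f2f3, and a vertex f4. For each other listed
graph H there are a few fixed ways to read this labelling as a labelled copy of H. Two successful
readings would give some vertex both ends of an edge as neighbours, hence a triangle, so at most one
succeeds; in a complete bipartite graph the colours always make one succeed. After division by
automorphism numbers, `graphM'`, `graphC4'` and `graphP5` have at most M copies, with equality for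
complete bipartite graphs. For K23 the labellings read as pentagons are disjoint from those read as
K23, which gives 6 K23 + 5 C5 ≤ M.

It remains to show that M + C5 is at most the value of M in the Turán graph. By Füredi's stability
argument there is a set B with independent complement such that e(G) + e(B) ≤ t, where t = ⌊n²/4⌋.
Deleting the ends of an edge leaves n - 2 vertices, to which Mantel's bound applies; hence each
ordered edge starts at most X labelled copies of `graphM`, with X the value attained in the Turán
graph. So 8 M ≤ 2e(G) X. Every pentagon has an edge in B, and a labelled copy of `graphM` starting
there completes to at most one pentagon, so 8 C5 ≤ 2e(B) X. The sum is at most 2tX, which is 8 M for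
the Turán graph.

Thus every entry other than `graphC5` leaves room for all the pentagons. As `graphC5` occurs at most
once and k ≥ 2, another entry absorbs it. -/

open Finset

/-! ### Labelled copies and counting by relabelling -/

/-- The labelled copies of `H` in `G`, as injective functions preserving adjacency. -/
noncomputable def labelledCopies {V : Type*} [Fintype V] (H : SimpleGraph (Fin 5))
    (G : SimpleGraph V) : Finset (Fin 5 → V) := by
  classical exact {f | Function.Injective f ∧ ∀ i j, H.Adj i j → G.Adj (f i) (f j)}

/-- `r` relabellings of `A` with disjoint images inside `B`. -/
theorem mul_card_le_of_relabel {V : Type*} {r : ℕ} {A B : Finset (Fin 5 → V)}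
    (p : Fin r → Fin 5 → Fin 5) (hp : ∀ i, Function.Bijective (p i))
    (hB : ∀ i f, f ∘ p i ∈ A → f ∈ B)
    (huniq : ∀ i j f, f ∘ p i ∈ A → f ∘ p j ∈ A → i = j) : r * #A ≤ #B := by
  choose q hq hq' using fun i ↦ Function.bijective_iff_has_inverse.1 (hp i)
  have hinv (i) (g : Fin 5 → V) : (g ∘ q i) ∘ p i = g := by
    funext x; simp [hq i x]
  have : #((univ : Finset (Fin r)) ×ˢ A) ≤ #B := by
    refine card_le_card_of_injOn (fun x ↦ x.2 ∘ q x.1) ?_ ?_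
    · rintro ⟨i, g⟩ h
      exact hB i _ (by simpa [hinv] using h)
    · rintro ⟨i, g⟩ h ⟨j, g'⟩ h' e
      simp only [coe_product, Set.mem_prod, mem_coe, coe_univ] at h h' e
      have hij : i = j := huniq i j (g ∘ q i) (by rw [hinv]; exact h.2)
        (by rw [e, hinv]; exact h'.2)
      subst hij
      have := congrArg (· ∘ p i) e
      simp only [hinv] at this
      rw [this]
  simpa using this

/-- `r` relabellings of `A` whose images cover `B`. -/
theorem card_le_mul_of_relabel {V : Type*} {r : ℕ} {A B : Finset (Fin 5 → V)}
    (p : Fin r → Fin 5 → Fin 5) (hp : ∀ i, Function.Bijective (p i))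
    (hB : ∀ f ∈ B, ∃ i, f ∘ p i ∈ A) : #B ≤ r * #A := by
  have : #B ≤ #((univ : Finset (Fin r)) ×ˢ A) := by
    obtain rfl | ⟨f₀, hf₀⟩ := B.eq_empty_or_nonempty
    · simp
    have : Nonempty (Fin r) := ⟨(hB f₀ hf₀).choose⟩
    choose! i hi using hB
    refine card_le_card_of_injOn (fun f ↦ (i f, f ∘ p (i f))) ?_ ?_
    · intro f hf
      simpa using hi f hf
    · intro f _ g _ e
      obtain ⟨h1, h2⟩ := Prod.mk.inj e
      rw [h1] at h2
      exact (hp _).surjective.injective_comp_right h2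
  simpa using this

/-! ### Labelled copies against copies; the six graphs -/

section LabelledCopies

variable {V : Type*} [Fintype V] {H : SimpleGraph (Fin 5)} {G : SimpleGraph V}

theorem mem_labelledCopies {f : Fin 5 → V} : f ∈ labelledCopies H G ↔
    Function.Injective f ∧ ∀ i j, H.Adj i j → G.Adj (f i) (f j) := by
  simp [labelledCopies]

/-- Each copy of `H` carries as many labelled copies as `H` has automorphisms. -/
theorem card_labelledCopies_eq_mul_copyCount (H : SimpleGraph (Fin 5)) (G : SimpleGraph V) :
    #(labelledCopies H G) = #(labelledCopies H H) * G.copyCount H := by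
  classical
  have key : ∀ f ∈ labelledCopies H G, ∃ c : H.Copy G, ⇑c = f := fun f hf ↦
    ⟨⟨⟨f, fun {i j} h ↦ (mem_labelledCopies.1 hf).2 i j h⟩, (mem_labelledCopies.1 hf).1⟩, rfl⟩
  let sub : (Fin 5 → V) → G.Subgraph := fun f ↦
    if h : ∃ c : H.Copy G, ⇑c = f then h.choose.toSubgraph else ⊥
  have sub_coe (c : H.Copy G) : sub c = c.toSubgraph := by
    have h : ∃ c' : H.Copy G, ⇑c' = c := ⟨c, rfl⟩
    have := h.choose_spec
    simp only [sub, dif_pos h]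
    rw [DFunLike.coe_injective this]
  have coe_mem (c : H.Copy G) : ⇑c ∈ labelledCopies H G :=
    mem_labelledCopies.2 ⟨c.injective, fun i j h ↦ c.toHom.map_adj h⟩
  rw [SimpleGraph.copyCount, mul_comm]
  refine (card_eq_sum_card_fiberwise (f := sub) ?_).trans (sum_const_nat ?_)
  · intro f hf
    obtain ⟨c, rfl⟩ := key f hf
    rw [sub_coe]
    simpa using ⟨c.isoToSubgraph⟩
  · intro G' hG'
    obtain ⟨c, rfl⟩ : G' ∈ Set.range (SimpleGraph.Copy.toSubgraph (A := H) (B := G)) := by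
      rw [SimpleGraph.Copy.range_toSubgraph]; simpa using hG'
    symm
    refine card_nbij (fun σ ↦ c ∘ σ) ?_ ?_ ?_
    · intro σ hσ
      obtain ⟨hσ, hσ'⟩ := mem_labelledCopies.1 hσ
      let s : H.Copy H := ⟨⟨σ, fun {i j} h ↦ hσ' i j h⟩, hσ⟩
      have e : c ∘ σ = ⇑(c.comp s) := by ext; rfl
      change c ∘ σ ∈ (filter _ _ : Finset _)
      rw [mem_filter, e]
      refine ⟨coe_mem _, ?_⟩
      rw [sub_coe]
      -- An injective homomorphism from a finite graph to itself is an automorphism: it permutes the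
      -- finite set of adjacent pairs, so it also reflects adjacency.
      have hmap : SimpleGraph.Subgraph.map s.toHom ⊤ = (⊤ : H.Subgraph) := by
        have hsurj : Function.Surjective σ := Finite.surjective_of_injective hσ
        refine SimpleGraph.Subgraph.ext ?_ ?_
        · simpa [SimpleGraph.Subgraph.map] using
            show Set.range (fun a ↦ s a) = Set.univ from hsurj.range_eq
        · have hfin := Finset.card_image_of_injOn
            (s := (univ : Finset (Fin 5 × Fin 5)).filter fun p ↦ H.Adj p.1 p.2)
            (f := Prod.map σ σ) (hσ.prodMap hσ).injOn
          have hss : (((univ : Finset (Fin 5 × Fin 5)).filter fun p ↦ H.Adj p.1 p.2).image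
              (Prod.map σ σ)) ⊆ (univ : Finset (Fin 5 × Fin 5)).filter fun p ↦ H.Adj p.1 p.2 := by
            intro p hp
            obtain ⟨q, hq, rfl⟩ := mem_image.1 hp
            simpa using hσ' _ _ (by simpa using hq)
          have heq := eq_of_subset_of_card_le hss hfin.ge
          ext i j
          have hij : (i, j) ∈ (((univ : Finset (Fin 5 × Fin 5)).filter fun p ↦
              H.Adj p.1 p.2).image (Prod.map σ σ)) ↔ H.Adj i j := by rw [heq]; simp
          simp only [mem_image, mem_filter, mem_univ, true_and, Prod.exists, Prod.map_apply,
            Prod.mk.injEq] at hij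
          simp only [SimpleGraph.Subgraph.map_adj, Relation.Map, SimpleGraph.Subgraph.top_adj]
          exact hij
      have : (c.comp s).toSubgraph = (SimpleGraph.Subgraph.map s.toHom ⊤).map c.toHom := by
        rw [← SimpleGraph.Subgraph.map_comp]; rfl
      rw [this, hmap]
    · intro σ _ τ _ h
      funext i
      exact c.injective (congrFun h i)
    · intro f hf
      obtain ⟨hf, hs⟩ := mem_filter.1 hf
      obtain ⟨d, rfl⟩ := key f hf
      rw [sub_coe] at hs
      have hv : ∀ i, ∃ j, c j = d i := by
        intro i
        have : d i ∈ d.toSubgraph.verts := by simp [SimpleGraph.Copy.toSubgraph]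
        rw [hs] at this
        simpa [SimpleGraph.Copy.toSubgraph] using this
      choose σ hσ using hv
      refine ⟨σ, mem_labelledCopies.2 ⟨fun i j h ↦ ?_, fun i j h ↦ ?_⟩, funext hσ⟩
      · apply d.injective
        change d i = d j
        rw [← hσ, ← hσ, h]
      · have : d.toSubgraph.Adj (d i) (d j) := ⟨i, j, h, rfl, rfl⟩
        rw [hs] at this
        obtain ⟨a, b, hab, ha, hb⟩ := this
        rw [← hσ] at ha hb
        rwa [c.injective ha, c.injective hb] at hab

theorem graphM_adj {i j : Fin 5} : graphM.Adj i j ↔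
    (i = 0 ∧ j = 1 ∨ i = 1 ∧ j = 0) ∨ (i = 2 ∧ j = 3 ∨ i = 3 ∧ j = 2) := by
  simp only [graphM, SimpleGraph.fromEdgeSet_adj, Set.mem_insert_iff, Set.mem_singleton_iff,
    Sym2.eq_iff]
  revert i j; decide

theorem graphM'_adj {i j : Fin 5} : graphM'.Adj i j ↔
    (i = 0 ∧ j = 1 ∨ i = 1 ∧ j = 0) ∨ (i = 1 ∧ j = 2 ∨ i = 2 ∧ j = 1) ∨
      (i = 3 ∧ j = 4 ∨ i = 4 ∧ j = 3) := by
  simp only [graphM', SimpleGraph.fromEdgeSet_adj, Set.mem_insert_iff, Set.mem_singleton_iff,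
    Sym2.eq_iff]
  revert i j; decide

theorem graphC4'_adj {i j : Fin 5} : graphC4'.Adj i j ↔
    (i = 0 ∧ j = 1 ∨ i = 1 ∧ j = 0) ∨ (i = 1 ∧ j = 2 ∨ i = 2 ∧ j = 1) ∨
      (i = 2 ∧ j = 3 ∨ i = 3 ∧ j = 2) ∨ (i = 3 ∧ j = 0 ∨ i = 0 ∧ j = 3) ∨
        (i = 0 ∧ j = 4 ∨ i = 4 ∧ j = 0) := by
  simp only [graphC4', SimpleGraph.fromEdgeSet_adj, Set.mem_insert_iff, Set.mem_singleton_iff,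
    Sym2.eq_iff]
  revert i j; decide

theorem graphP5_adj {i j : Fin 5} : graphP5.Adj i j ↔
    (i = 0 ∧ j = 1 ∨ i = 1 ∧ j = 0) ∨ (i = 1 ∧ j = 2 ∨ i = 2 ∧ j = 1) ∨
      (i = 2 ∧ j = 3 ∨ i = 3 ∧ j = 2) ∨ (i = 3 ∧ j = 4 ∨ i = 4 ∧ j = 3) := by
  simp only [graphP5, SimpleGraph.pathGraph_adj]
  revert i j; decide

theorem graphC5_adj {i j : Fin 5} : graphC5.Adj i j ↔
    (i = 0 ∧ j = 1 ∨ i = 1 ∧ j = 0) ∨ (i = 1 ∧ j = 2 ∨ i = 2 ∧ j = 1) ∨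
      (i = 2 ∧ j = 3 ∨ i = 3 ∧ j = 2) ∨ (i = 3 ∧ j = 4 ∨ i = 4 ∧ j = 3) ∨
        (i = 4 ∧ j = 0 ∨ i = 0 ∧ j = 4) := by
  simp only [graphC5, SimpleGraph.cycleGraph_adj]
  revert i j; decide

theorem graphK23_adj {i j : Fin 5} : graphK23.Adj i j ↔ (i < 2 ∧ 2 ≤ j ∨ 2 ≤ i ∧ j < 2) := by
  simp only [graphK23, SimpleGraph.comap_adj, completeBipartiteGraph_adj]
  revert i j; decide

theorem mem_labelledCopies_graphM {f : Fin 5 → V} : f ∈ labelledCopies graphM G ↔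
    Function.Injective f ∧ G.Adj (f 0) (f 1) ∧ G.Adj (f 2) (f 3) := by
  simp only [mem_labelledCopies, graphM_adj, and_congr_right_iff]
  refine fun _ ↦ ⟨fun h ↦ ⟨h _ _ (by simp), h _ _ (by simp)⟩, fun h i j hij ↦ ?_⟩
  rcases hij with (⟨rfl, rfl⟩ | ⟨rfl, rfl⟩) | ⟨rfl, rfl⟩ | ⟨rfl, rfl⟩ <;> simp [h, G.adj_comm]

end LabelledCopies

section LabelledCopies

variable {V : Type*} [Fintype V] {H : SimpleGraph (Fin 5)} {G : SimpleGraph V}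

theorem mem_labelledCopies_graphM' {f : Fin 5 → V} : f ∈ labelledCopies graphM' G ↔
    Function.Injective f ∧ G.Adj (f 0) (f 1) ∧ G.Adj (f 1) (f 2) ∧ G.Adj (f 3) (f 4) := by
  simp only [mem_labelledCopies, graphM'_adj, and_congr_right_iff]
  refine fun _ ↦ ⟨fun h ↦ ⟨h _ _ (by simp), h _ _ (by simp), h _ _ (by simp)⟩, fun h i j hij ↦ ?_⟩
  rcases hij with (⟨rfl, rfl⟩ | ⟨rfl, rfl⟩) | (⟨rfl, rfl⟩ | ⟨rfl, rfl⟩) | ⟨rfl, rfl⟩ | ⟨rfl, rfl⟩ <;>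
    simp [h, G.adj_comm]

theorem mem_labelledCopies_graphC4' {f : Fin 5 → V} : f ∈ labelledCopies graphC4' G ↔
    Function.Injective f ∧ G.Adj (f 0) (f 1) ∧ G.Adj (f 1) (f 2) ∧ G.Adj (f 2) (f 3) ∧
      G.Adj (f 3) (f 0) ∧ G.Adj (f 0) (f 4) := by
  simp only [mem_labelledCopies, graphC4'_adj, and_congr_right_iff]
  refine fun _ ↦ ⟨fun h ↦ ⟨h _ _ (by simp), h _ _ (by simp), h _ _ (by simp), h _ _ (by simp),
    h _ _ (by simp)⟩, fun h i j hij ↦ ?_⟩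
  rcases hij with (⟨rfl, rfl⟩ | ⟨rfl, rfl⟩) | (⟨rfl, rfl⟩ | ⟨rfl, rfl⟩) |
    (⟨rfl, rfl⟩ | ⟨rfl, rfl⟩) | (⟨rfl, rfl⟩ | ⟨rfl, rfl⟩) | ⟨rfl, rfl⟩ | ⟨rfl, rfl⟩ <;>
    tauto

theorem mem_labelledCopies_graphP5 {f : Fin 5 → V} : f ∈ labelledCopies graphP5 G ↔
    Function.Injective f ∧ G.Adj (f 0) (f 1) ∧ G.Adj (f 1) (f 2) ∧ G.Adj (f 2) (f 3) ∧
      G.Adj (f 3) (f 4) := by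
  simp only [mem_labelledCopies, graphP5_adj, and_congr_right_iff]
  refine fun _ ↦ ⟨fun h ↦ ⟨h _ _ (by simp), h _ _ (by simp), h _ _ (by simp), h _ _ (by simp)⟩,
    fun h i j hij ↦ ?_⟩
  rcases hij with (⟨rfl, rfl⟩ | ⟨rfl, rfl⟩) | (⟨rfl, rfl⟩ | ⟨rfl, rfl⟩) |
    (⟨rfl, rfl⟩ | ⟨rfl, rfl⟩) | ⟨rfl, rfl⟩ | ⟨rfl, rfl⟩ <;>
    tauto

theorem mem_labelledCopies_graphC5 {f : Fin 5 → V} : f ∈ labelledCopies graphC5 G ↔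
    Function.Injective f ∧ G.Adj (f 0) (f 1) ∧ G.Adj (f 1) (f 2) ∧ G.Adj (f 2) (f 3) ∧
      G.Adj (f 3) (f 4) ∧ G.Adj (f 4) (f 0) := by
  simp only [mem_labelledCopies, graphC5_adj, and_congr_right_iff]
  refine fun _ ↦ ⟨fun h ↦ ⟨h _ _ (by simp), h _ _ (by simp), h _ _ (by simp), h _ _ (by simp),
    h _ _ (by simp)⟩, fun h i j hij ↦ ?_⟩
  rcases hij with (⟨rfl, rfl⟩ | ⟨rfl, rfl⟩) | (⟨rfl, rfl⟩ | ⟨rfl, rfl⟩) |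
    (⟨rfl, rfl⟩ | ⟨rfl, rfl⟩) | (⟨rfl, rfl⟩ | ⟨rfl, rfl⟩) | ⟨rfl, rfl⟩ | ⟨rfl, rfl⟩ <;>
    tauto

theorem mem_labelledCopies_graphK23 {f : Fin 5 → V} : f ∈ labelledCopies graphK23 G ↔
    Function.Injective f ∧ (G.Adj (f 0) (f 2) ∧ G.Adj (f 0) (f 3) ∧ G.Adj (f 0) (f 4)) ∧
      G.Adj (f 1) (f 2) ∧ G.Adj (f 1) (f 3) ∧ G.Adj (f 1) (f 4) := by
  simp only [mem_labelledCopies, graphK23_adj, and_congr_right_iff]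
  refine fun _ ↦ ⟨fun h ↦ ⟨⟨h _ _ (by decide), h _ _ (by decide), h _ _ (by decide)⟩,
    h _ _ (by decide), h _ _ (by decide), h _ _ (by decide)⟩, fun h i j hij ↦ ?_⟩
  have key : ∀ i j : Fin 5, i < 2 → 2 ≤ j → G.Adj (f i) (f j) := by
    intro i j hi hj
    fin_cases i <;> fin_cases j <;> 
      first
        | exact absurd hi (by decide)
        | exact absurd hj (by decide)
        | simp [h]
  rcases hij with ⟨hi, hj⟩ | ⟨hi, hj⟩
  exacts [key i j hi hj, (key j i hj hi).symm]

end LabelledCopies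

/-- Here and in the five analogues below, the constant is the order of the automorphism group, found
by evaluation over all maps `Fin 5 → Fin 5`. -/
theorem card_labelledCopies_graphM {V : Type*} [Fintype V] (G : SimpleGraph V) :
    #(labelledCopies graphM G) = 8 * G.copyCount graphM := by
  have : DecidableRel graphM.Adj := fun _ _ ↦ decidable_of_iff' _ graphM_adj
  have h : labelledCopies graphM graphM = univ.filter fun f : Fin 5 → Fin 5 ↦
      Function.Injective f ∧ ∀ i j, graphM.Adj i j → graphM.Adj (f i) (f j) := by
    ext f; simp [mem_labelledCopies]
  rw [card_labelledCopies_eq_mul_copyCount, h]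
  congr 1
  simp only [graphM_adj]
  decide +kernel

theorem card_labelledCopies_graphM' {V : Type*} [Fintype V] (G : SimpleGraph V) :
    #(labelledCopies graphM' G) = 4 * G.copyCount graphM' := by
  have : DecidableRel graphM'.Adj := fun _ _ ↦ decidable_of_iff' _ graphM'_adj
  have h : labelledCopies graphM' graphM' = univ.filter fun f : Fin 5 → Fin 5 ↦
      Function.Injective f ∧ ∀ i j, graphM'.Adj i j → graphM'.Adj (f i) (f j) := by
    ext f; simp [mem_labelledCopies]
  rw [card_labelledCopies_eq_mul_copyCount, h]
  congr 1
  simp only [graphM'_adj]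
  decide +kernel

theorem card_labelledCopies_graphC4' {V : Type*} [Fintype V] (G : SimpleGraph V) :
    #(labelledCopies graphC4' G) = 2 * G.copyCount graphC4' := by
  have : DecidableRel graphC4'.Adj := fun _ _ ↦ decidable_of_iff' _ graphC4'_adj
  have h : labelledCopies graphC4' graphC4' = univ.filter fun f : Fin 5 → Fin 5 ↦
      Function.Injective f ∧ ∀ i j, graphC4'.Adj i j → graphC4'.Adj (f i) (f j) := by
    ext f; simp [mem_labelledCopies]
  rw [card_labelledCopies_eq_mul_copyCount, h]
  congr 1
  simp only [graphC4'_adj]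
  decide +kernel

theorem card_labelledCopies_graphP5 {V : Type*} [Fintype V] (G : SimpleGraph V) :
    #(labelledCopies graphP5 G) = 2 * G.copyCount graphP5 := by
  have : DecidableRel graphP5.Adj := fun _ _ ↦ decidable_of_iff' _ graphP5_adj
  have h : labelledCopies graphP5 graphP5 = univ.filter fun f : Fin 5 → Fin 5 ↦
      Function.Injective f ∧ ∀ i j, graphP5.Adj i j → graphP5.Adj (f i) (f j) := by
    ext f; simp [mem_labelledCopies]
  rw [card_labelledCopies_eq_mul_copyCount, h]
  congr 1
  simp only [graphP5_adj]
  decide +kernel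

theorem card_labelledCopies_graphK23 {V : Type*} [Fintype V] (G : SimpleGraph V) :
    #(labelledCopies graphK23 G) = 12 * G.copyCount graphK23 := by
  have : DecidableRel graphK23.Adj := fun _ _ ↦ decidable_of_iff' _ graphK23_adj
  have h : labelledCopies graphK23 graphK23 = univ.filter fun f : Fin 5 → Fin 5 ↦
      Function.Injective f ∧ ∀ i j, graphK23.Adj i j → graphK23.Adj (f i) (f j) := by
    ext f; simp [mem_labelledCopies]
  rw [card_labelledCopies_eq_mul_copyCount, h]
  congr 1
  simp only [graphK23_adj]
  decide +kernel

theorem card_labelledCopies_graphC5 {V : Type*} [Fintype V] (G : SimpleGraph V) :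
    #(labelledCopies graphC5 G) = 10 * G.copyCount graphC5 := by
  have : DecidableRel graphC5.Adj := fun _ _ ↦ decidable_of_iff' _ graphC5_adj
  have h : labelledCopies graphC5 graphC5 = univ.filter fun f : Fin 5 → Fin 5 ↦
      Function.Injective f ∧ ∀ i j, graphC5.Adj i j → graphC5.Adj (f i) (f j) := by
    ext f; simp [mem_labelledCopies]
  rw [card_labelledCopies_eq_mul_copyCount, h]
  congr 1
  simp only [graphC5_adj]
  decide +kernel

/-- Two families of relabellings, of `A` and of `A'`, with pairwise disjoint images inside `B`. -/
theorem mul_card_add_mul_card_le_of_relabel {V : Type*} {r s : ℕ} {A A' B : Finset (Fin 5 → V)}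
    (p : Fin r → Fin 5 → Fin 5) (hp : ∀ i, Function.Bijective (p i))
    (q : Fin s → Fin 5 → Fin 5) (hq : ∀ i, Function.Bijective (q i))
    (hB : ∀ i f, f ∘ p i ∈ A → f ∈ B) (hB' : ∀ i f, f ∘ q i ∈ A' → f ∈ B)
    (huniq : ∀ i j f, f ∘ p i ∈ A → f ∘ p j ∈ A → i = j)
    (huniq' : ∀ i j f, f ∘ q i ∈ A' → f ∘ q j ∈ A' → i = j)
    (hdisj : ∀ i j f, f ∘ p i ∈ A → f ∘ q j ∉ A') : r * #A + s * #A' ≤ #B := by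
  classical
  have h1 : r * #A ≤ #(B.filter fun f ↦ ∃ i, f ∘ p i ∈ A) :=
    mul_card_le_of_relabel p hp (fun i f h ↦ mem_filter.2 ⟨hB i f h, i, h⟩) huniq
  have h2 : s * #A' ≤ #(B.filter fun f ↦ ¬ ∃ i, f ∘ p i ∈ A) :=
    mul_card_le_of_relabel q hq (fun i f h ↦ mem_filter.2 ⟨hB' i f h,
      fun ⟨j, hj⟩ ↦ hdisj j i f hj h⟩) huniq'
  rw [← card_filter_add_card_filter_not (s := B) fun f ↦ ∃ i, f ∘ p i ∈ A]
  exact add_le_add h1 h2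

/-! ### Comparison of each graph with `graphM` -/

section Comparison

variable {V : Type*} [Fintype V] {G : SimpleGraph V}

/-- The relabellings of a labelled copy of `graphM` to a five-vertex walk starting at its isolated
vertex. -/
def walkRelabel : Fin 4 → Fin 5 → Fin 5 :=
  ![![4, 0, 1, 2, 3], ![4, 0, 1, 3, 2], ![4, 1, 0, 2, 3], ![4, 1, 0, 3, 2]]

/-- The relabellings of a labelled copy of `graphM` that may give a copy of `graphK23`. -/
def bicliqueRelabel : Fin 4 → Fin 5 → Fin 5 :=
  ![![0, 2, 1, 3, 4], ![0, 3, 1, 2, 4], ![1, 2, 0, 3, 4], ![1, 3, 0, 2, 4]]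

/-- The relabellings of a labelled copy of `graphM` that may give a copy of `graphC4'`. -/
def panRelabel : Fin 4 → Fin 5 → Fin 5 :=
  ![![0, 1, 2, 3, 4], ![0, 1, 3, 2, 4], ![1, 0, 2, 3, 4], ![1, 0, 3, 2, 4]]

/-- The relabellings of a labelled copy of `graphM` that may give a copy of `graphM'`. -/
def forestRelabel : Fin 2 → Fin 5 → Fin 5 :=
  ![![4, 0, 1, 2, 3], ![4, 1, 0, 2, 3]]

theorem forestRelabel_bijective : ∀ i, Function.Bijective (forestRelabel i) := by decide

theorem walkRelabel_bijective : ∀ i, Function.Bijective (walkRelabel i) := by decide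

theorem panRelabel_bijective : ∀ i, Function.Bijective (panRelabel i) := by decide

theorem bicliqueRelabel_bijective : ∀ i, Function.Bijective (bicliqueRelabel i) := by decide

theorem mem_graphM_of_graphM' (i : Fin 2) (f : Fin 5 → V)
    (hf : f ∘ forestRelabel i ∈ labelledCopies graphM' G) : f ∈ labelledCopies graphM G := by
  rw [mem_labelledCopies_graphM'] at hf
  rw [mem_labelledCopies_graphM]
  refine ⟨hf.1.of_comp_right (forestRelabel_bijective i).surjective, ?_⟩
  have h01 := G.adj_comm (f 0) (f 1)
  have h23 := G.adj_comm (f 2) (f 3)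
  fin_cases i <;> simp [forestRelabel] at hf <;> tauto

theorem mem_graphM_of_graphP5 (i : Fin 4) (f : Fin 5 → V)
    (hf : f ∘ walkRelabel i ∈ labelledCopies graphP5 G) : f ∈ labelledCopies graphM G := by
  rw [mem_labelledCopies_graphP5] at hf
  rw [mem_labelledCopies_graphM]
  refine ⟨hf.1.of_comp_right (walkRelabel_bijective i).surjective, ?_⟩
  have h01 := G.adj_comm (f 0) (f 1)
  have h23 := G.adj_comm (f 2) (f 3)
  fin_cases i <;> simp [walkRelabel] at hf <;> tauto

theorem mem_graphM_of_graphC4' (i : Fin 4) (f : Fin 5 → V)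
    (hf : f ∘ panRelabel i ∈ labelledCopies graphC4' G) : f ∈ labelledCopies graphM G := by
  rw [mem_labelledCopies_graphC4'] at hf
  rw [mem_labelledCopies_graphM]
  refine ⟨hf.1.of_comp_right (panRelabel_bijective i).surjective, ?_⟩
  have h01 := G.adj_comm (f 0) (f 1)
  have h23 := G.adj_comm (f 2) (f 3)
  fin_cases i <;> simp [panRelabel] at hf <;> tauto

theorem mem_graphM_of_graphK23 (i : Fin 4) (f : Fin 5 → V)
    (hf : f ∘ bicliqueRelabel i ∈ labelledCopies graphK23 G) : f ∈ labelledCopies graphM G := by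
  rw [mem_labelledCopies_graphK23] at hf
  rw [mem_labelledCopies_graphM]
  refine ⟨hf.1.of_comp_right (bicliqueRelabel_bijective i).surjective, ?_⟩
  have h01 := G.adj_comm (f 0) (f 1)
  have h23 := G.adj_comm (f 2) (f 3)
  fin_cases i <;> simp [bicliqueRelabel] at hf <;> tauto

theorem mem_graphM_of_graphC5 (i : Fin 4) (f : Fin 5 → V)
    (hf : f ∘ walkRelabel i ∈ labelledCopies graphC5 G) : f ∈ labelledCopies graphM G := by
  rw [mem_labelledCopies_graphC5] at hf
  rw [mem_labelledCopies_graphM]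
  refine ⟨hf.1.of_comp_right (walkRelabel_bijective i).surjective, ?_⟩
  have h01 := G.adj_comm (f 0) (f 1)
  have h23 := G.adj_comm (f 2) (f 3)
  fin_cases i <;> simp [walkRelabel] at hf <;> tauto

/-- Were both relabellings valid, `f 4` would be adjacent to both ends of the edge `f 0`, `f 1`. The
next four lemmas rest on the same obstruction: any two distinct relabellings join some vertex to
both ends of one of the two edges. -/
theorem relabel_unique_graphM' (hG : ∀ a b c, G.Adj a b → G.Adj b c → ¬ G.Adj a c)
    (i j : Fin 2) (f : Fin 5 → V) (hi : f ∘ forestRelabel i ∈ labelledCopies graphM' G)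
    (hj : f ∘ forestRelabel j ∈ labelledCopies graphM' G) : i = j := by
  simp only [mem_labelledCopies_graphM'] at hi hj
  have := fun a b c h1 h2 ↦ hG (f a) (f b) (f c) h1 h2
  have := fun a b ↦ G.adj_comm (f a) (f b)
  fin_cases i <;> fin_cases j <;> simp [forestRelabel] at hi hj ⊢ <;> grind

theorem relabel_unique_graphP5 (hG : ∀ a b c, G.Adj a b → G.Adj b c → ¬ G.Adj a c)
    (i j : Fin 4) (f : Fin 5 → V) (hi : f ∘ walkRelabel i ∈ labelledCopies graphP5 G)
    (hj : f ∘ walkRelabel j ∈ labelledCopies graphP5 G) : i = j := by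
  simp only [mem_labelledCopies_graphP5] at hi hj
  have := fun a b c h1 h2 ↦ hG (f a) (f b) (f c) h1 h2
  have := fun a b ↦ G.adj_comm (f a) (f b)
  fin_cases i <;> fin_cases j <;> simp [walkRelabel] at hi hj ⊢ <;> grind

theorem relabel_unique_graphC4' (hG : ∀ a b c, G.Adj a b → G.Adj b c → ¬ G.Adj a c)
    (i j : Fin 4) (f : Fin 5 → V) (hi : f ∘ panRelabel i ∈ labelledCopies graphC4' G)
    (hj : f ∘ panRelabel j ∈ labelledCopies graphC4' G) : i = j := by
  simp only [mem_labelledCopies_graphC4'] at hi hj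
  have := fun a b c h1 h2 ↦ hG (f a) (f b) (f c) h1 h2
  have := fun a b ↦ G.adj_comm (f a) (f b)
  fin_cases i <;> fin_cases j <;> simp [panRelabel] at hi hj ⊢ <;> grind

theorem relabel_unique_graphK23 (hG : ∀ a b c, G.Adj a b → G.Adj b c → ¬ G.Adj a c)
    (i j : Fin 4) (f : Fin 5 → V) (hi : f ∘ bicliqueRelabel i ∈ labelledCopies graphK23 G)
    (hj : f ∘ bicliqueRelabel j ∈ labelledCopies graphK23 G) : i = j := by
  simp only [mem_labelledCopies_graphK23] at hi hj
  have := fun a b c h1 h2 ↦ hG (f a) (f b) (f c) h1 h2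
  have := fun a b ↦ G.adj_comm (f a) (f b)
  fin_cases i <;> fin_cases j <;> simp [bicliqueRelabel] at hi hj ⊢ <;> grind

theorem relabel_unique_graphC5 (hG : ∀ a b c, G.Adj a b → G.Adj b c → ¬ G.Adj a c)
    (i j : Fin 4) (f : Fin 5 → V) (hi : f ∘ walkRelabel i ∈ labelledCopies graphC5 G)
    (hj : f ∘ walkRelabel j ∈ labelledCopies graphC5 G) : i = j := by
  simp only [mem_labelledCopies_graphC5] at hi hj
  have := fun a b c h1 h2 ↦ hG (f a) (f b) (f c) h1 h2
  have := fun a b ↦ G.adj_comm (f a) (f b)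
  fin_cases i <;> fin_cases j <;> simp [walkRelabel] at hi hj ⊢ <;> grind

/-- Adding any edge to the complete bipartite graph on these five vertices creates a triangle, so
they induce exactly `graphK23`, which is bipartite and has no 5-cycle. Disjointness is what lets the
two counts be added. -/
theorem relabel_graphC5_of_graphK23 (hG : ∀ a b c, G.Adj a b → G.Adj b c → ¬ G.Adj a c)
    (i j : Fin 4) (f : Fin 5 → V) (hi : f ∘ bicliqueRelabel i ∈ labelledCopies graphK23 G) :
    f ∘ walkRelabel j ∉ labelledCopies graphC5 G := by
  intro hj
  simp only [mem_labelledCopies_graphK23, mem_labelledCopies_graphC5] at hi hj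
  have := fun a b c h1 h2 ↦ hG (f a) (f b) (f c) h1 h2
  have := fun a b ↦ G.adj_comm (f a) (f b)
  fin_cases i <;> fin_cases j <;> simp [bicliqueRelabel, walkRelabel] at hi hj <;> grind

/-- Each of the two edges has one end of either colour, so the colour of `f 4` decides which end it
is joined to. The same choice by colours serves the other graphs; for `graphK23`, the class of `f 4`
is the side of size three. -/
theorem exists_relabel_graphM' {c : V → Bool} (hc : ∀ a b, G.Adj a b ↔ c a ≠ c b)
    (f : Fin 5 → V) (hf : f ∈ labelledCopies graphM G) :
    ∃ i, f ∘ forestRelabel i ∈ labelledCopies graphM' G := by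
  simp only [mem_labelledCopies_graphM, mem_labelledCopies_graphM', hc] at hf ⊢
  obtain ⟨hf, h01, h23⟩ := hf
  simp only [fun i ↦ hf.comp (forestRelabel_bijective i).injective, true_and]
  simp [Fin.exists_fin_succ, forestRelabel]
  grind

theorem copyCount_graphM'_le (hG : ∀ a b c, G.Adj a b → G.Adj b c → ¬ G.Adj a c) :
    G.copyCount graphM' ≤ G.copyCount graphM := by
  have := mul_card_le_of_relabel forestRelabel forestRelabel_bijective mem_graphM_of_graphM'
    (relabel_unique_graphM' hG)
  rw [card_labelledCopies_graphM, card_labelledCopies_graphM'] at this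
  lia

theorem copyCount_graphM_le_graphM' {c : V → Bool} (hc : ∀ a b, G.Adj a b ↔ c a ≠ c b) :
    G.copyCount graphM ≤ G.copyCount graphM' := by
  have := card_le_mul_of_relabel forestRelabel forestRelabel_bijective (exists_relabel_graphM' hc)
  rw [card_labelledCopies_graphM, card_labelledCopies_graphM'] at this
  lia

theorem exists_relabel_graphP5 {c : V → Bool} (hc : ∀ a b, G.Adj a b ↔ c a ≠ c b)
    (f : Fin 5 → V) (hf : f ∈ labelledCopies graphM G) :
    ∃ i, f ∘ walkRelabel i ∈ labelledCopies graphP5 G := by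
  simp only [mem_labelledCopies_graphM, mem_labelledCopies_graphP5, hc] at hf ⊢
  obtain ⟨hf, h01, h23⟩ := hf
  simp only [fun i ↦ hf.comp (walkRelabel_bijective i).injective, true_and]
  simp [Fin.exists_fin_succ, walkRelabel]
  grind

theorem copyCount_graphP5_le (hG : ∀ a b c, G.Adj a b → G.Adj b c → ¬ G.Adj a c) :
    G.copyCount graphP5 ≤ G.copyCount graphM := by
  have := mul_card_le_of_relabel walkRelabel walkRelabel_bijective mem_graphM_of_graphP5
    (relabel_unique_graphP5 hG)
  rw [card_labelledCopies_graphM, card_labelledCopies_graphP5] at this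
  lia

theorem copyCount_graphM_le_graphP5 {c : V → Bool} (hc : ∀ a b, G.Adj a b ↔ c a ≠ c b) :
    G.copyCount graphM ≤ G.copyCount graphP5 := by
  have := card_le_mul_of_relabel walkRelabel walkRelabel_bijective (exists_relabel_graphP5 hc)
  rw [card_labelledCopies_graphM, card_labelledCopies_graphP5] at this
  lia

theorem exists_relabel_graphC4' {c : V → Bool} (hc : ∀ a b, G.Adj a b ↔ c a ≠ c b)
    (f : Fin 5 → V) (hf : f ∈ labelledCopies graphM G) :
    ∃ i, f ∘ panRelabel i ∈ labelledCopies graphC4' G := by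
  simp only [mem_labelledCopies_graphM, mem_labelledCopies_graphC4', hc] at hf ⊢
  obtain ⟨hf, h01, h23⟩ := hf
  simp only [fun i ↦ hf.comp (panRelabel_bijective i).injective, true_and]
  simp [Fin.exists_fin_succ, panRelabel]
  grind

theorem copyCount_graphC4'_le (hG : ∀ a b c, G.Adj a b → G.Adj b c → ¬ G.Adj a c) :
    G.copyCount graphC4' ≤ G.copyCount graphM := by
  have := mul_card_le_of_relabel panRelabel panRelabel_bijective mem_graphM_of_graphC4'
    (relabel_unique_graphC4' hG)
  rw [card_labelledCopies_graphM, card_labelledCopies_graphC4'] at this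
  lia

theorem copyCount_graphM_le_graphC4' {c : V → Bool} (hc : ∀ a b, G.Adj a b ↔ c a ≠ c b) :
    G.copyCount graphM ≤ G.copyCount graphC4' := by
  have := card_le_mul_of_relabel panRelabel panRelabel_bijective (exists_relabel_graphC4' hc)
  rw [card_labelledCopies_graphM, card_labelledCopies_graphC4'] at this
  lia

theorem exists_relabel_graphK23 {c : V → Bool} (hc : ∀ a b, G.Adj a b ↔ c a ≠ c b)
    (f : Fin 5 → V) (hf : f ∈ labelledCopies graphM G) :
    ∃ i, f ∘ bicliqueRelabel i ∈ labelledCopies graphK23 G := by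
  simp only [mem_labelledCopies_graphM, mem_labelledCopies_graphK23, hc] at hf ⊢
  obtain ⟨hf, h01, h23⟩ := hf
  simp only [fun i ↦ hf.comp (bicliqueRelabel_bijective i).injective, true_and]
  simp [Fin.exists_fin_succ, bicliqueRelabel]
  grind

/-- Four relabellings each, with 12 and 10 automorphisms, against the 8 of `graphM`: the
coefficients are 48/8 and 40/8. The pentagon term is kept because comparing `graphK23` with the
Turán graph costs a factor 6, so six units of pentagon slack are needed. -/
theorem six_mul_copyCount_graphK23_add_le
    (hG : ∀ a b c, G.Adj a b → G.Adj b c → ¬ G.Adj a c) :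
    6 * G.copyCount graphK23 + 5 * G.copyCount graphC5 ≤ G.copyCount graphM := by
  have := mul_card_add_mul_card_le_of_relabel bicliqueRelabel bicliqueRelabel_bijective
    walkRelabel walkRelabel_bijective mem_graphM_of_graphK23 mem_graphM_of_graphC5
    (relabel_unique_graphK23 hG) (relabel_unique_graphC5 hG) (relabel_graphC5_of_graphK23 hG)
  rw [card_labelledCopies_graphM, card_labelledCopies_graphK23, card_labelledCopies_graphC5]
    at this
  lia

theorem copyCount_graphM_le_graphK23 {c : V → Bool} (hc : ∀ a b, G.Adj a b ↔ c a ≠ c b) :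
    G.copyCount graphM ≤ 6 * G.copyCount graphK23 := by
  have := card_le_mul_of_relabel bicliqueRelabel bicliqueRelabel_bijective
    (exists_relabel_graphK23 hc)
  rw [card_labelledCopies_graphM, card_labelledCopies_graphK23] at this
  lia

end Comparison

/-! ### Mantel's bound with stability -/

theorem mul_le_half_mul_half (a b : ℕ) : a * b ≤ (a + b) / 2 * ((a + b + 1) / 2) := by
  have h : (a + b) / 2 + (a + b + 1) / 2 = a + b := by lia
  have h' : (a + b + 1) / 2 ≤ (a + b) / 2 + 1 := by lia
  have h'' : (a + b) / 2 ≤ (a + b + 1) / 2 := by lia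
  generalize (a + b) / 2 = x at *
  generalize (a + b + 1) / 2 = y at *
  rcases le_total a x with ha | ha
  · obtain ⟨k, rfl⟩ := Nat.exists_eq_add_of_le ha
    have : b = y + k := by lia
    subst this
    nlinarith
  · obtain ⟨k, rfl⟩ := Nat.exists_eq_add_of_le ha
    have : y = b + k := by lia
    subst this
    -- Here `x * y - a * b = k * (k - (y - x))` with `y - x ≤ 1`, which is nonnegative because `k`
    -- is an integer.
    rcases Nat.eq_zero_or_pos k with rfl | hk
    · simp
    · nlinarith

section Stability

variable {V : Type*} [DecidableEq V] {G : SimpleGraph V} [DecidableRel G.Adj]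

/-- A triangle-free graph with few edges missing from the Turán bound can be made bipartite by
deleting at most as many edges (Füredi). Edges are counted twice, as pairs of `interedges`. -/
theorem exists_card_interedges_add_le (hG : ∀ a b c, G.Adj a b → G.Adj b c → ¬ G.Adj a c)
    (S : Finset V) : ∃ B ⊆ S, (∀ x ∈ S, ∀ y ∈ S, G.Adj x y → x ∈ B ∨ y ∈ B) ∧
      #(G.interedges S S) + #(G.interedges B B) ≤ 2 * (#S / 2 * ((#S + 1) / 2)) := by
  obtain rfl | hS := S.eq_empty_or_nonempty
  · exact ⟨∅, by simp⟩
  -- The cover is the set of non-neighbours of a vertex of maximum degree; its complement in `S`, a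
  -- neighbourhood, is independent.
  obtain ⟨x, hx, hmax⟩ := S.exists_max_image (fun x ↦ #(S.filter (G.Adj x))) hS
  set A := S.filter (G.Adj x) with hA
  have hAS : A ⊆ S := filter_subset _ _
  have hcov : ∀ u ∈ S, ∀ v ∈ S, G.Adj u v → u ∈ S \ A ∨ v ∈ S \ A := by
    intro u hu v hv huv
    by_contra! h
    simp only [hA, mem_sdiff, mem_filter, not_not, hu, hv, true_and] at h
    exact hG x u v h.1 huv h.2
  refine ⟨S \ A, sdiff_subset, hcov, ?_⟩
  -- Since `A` is independent, every edge meets `S \ A`. The degree sum over `S \ A` counts edges to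
  -- `A` once and edges inside twice, which is exactly the number of edges of `S` plus the number
  -- inside `S \ A`.
  have hsplit : #(G.interedges S S) + #(G.interedges (S \ A) (S \ A)) =
      2 * #(G.interedges (S \ A) S) := by
    have e1 : #(G.interedges S S) = #(G.interedges A S) + #(G.interedges (S \ A) S) := by
      rw [← card_union_of_disjoint (G.interedges_disjoint_left disjoint_sdiff _)]
      congr 1; ext ⟨u, v⟩; simp only [mem_union, SimpleGraph.mem_interedges_iff, mem_sdiff]
      have := @hAS u; tauto
    have e2 : #(G.interedges (S \ A) S) =
        #(G.interedges (S \ A) A) + #(G.interedges (S \ A) (S \ A)) := by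
      rw [← card_union_of_disjoint (G.interedges_disjoint_right _ disjoint_sdiff)]
      congr 1; ext ⟨u, v⟩; simp only [mem_union, SimpleGraph.mem_interedges_iff, mem_sdiff]
      have := @hAS v; tauto
    have e3 : G.interedges A S = G.interedges A (S \ A) := by
      ext ⟨u, v⟩; simp only [SimpleGraph.mem_interedges_iff, mem_sdiff]
      have := hcov u
      have := @hAS u
      grind
    have : Std.Symm G.Adj := ⟨fun _ _ h ↦ h.symm⟩
    have e4 : #(G.interedges A (S \ A)) = #(G.interedges (S \ A) A) :=
      Rel.card_interedges_comm _ _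
    lia
  -- By maximality, each degree in this sum is at most `#A`, the degree of `x`.
  have hle : #(G.interedges (S \ A) S) ≤ #(S \ A) * #A := by
    have : G.interedges (S \ A) S = (S \ A).biUnion fun b ↦ (S.filter (G.Adj b)).map
        (Function.Embedding.sectR b V) := by
      ext ⟨u, v⟩
      simp only [SimpleGraph.mem_interedges_iff, mem_biUnion, mem_map, mem_filter,
        Function.Embedding.sectR_apply, Prod.mk.injEq]
      grind
    rw [this]
    refine card_biUnion_le_card_mul _ _ _ fun b hb ↦ ?_
    rw [card_map]
    exact hmax b (mem_sdiff.1 hb).1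
  have hcard : #(S \ A) + #A = #S := card_sdiff_add_card_eq_card hAS
  have := mul_le_half_mul_half #(S \ A) #A
  rw [hcard] at this
  lia

end Stability

/-! ### Pentagons and pairs of edges through an edge of the cover -/

/-- Every pentagon has an edge inside a vertex set whose complement is independent. -/
theorem card_labelledCopies_graphC5_le {V : Type*} [Fintype V] [DecidableEq V]
    {G : SimpleGraph V} {B : Finset V}
    (hB : ∀ x y, G.Adj x y → x ∈ B ∨ y ∈ B) : #(labelledCopies graphC5 G) ≤
      5 * #((labelledCopies graphC5 G).filter fun f ↦ f 0 ∈ B ∧ f 1 ∈ B) := by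
  -- The five rotations of the cycle. If no rotation brought an edge inside `B` to the front,
  -- membership in `B` would alternate around an odd cycle.
  have hp : ∀ i, Function.Bijective ((![![0, 1, 2, 3, 4], ![1, 2, 3, 4, 0], ![2, 3, 4, 0, 1],
    ![3, 4, 0, 1, 2], ![4, 0, 1, 2, 3]] : Fin 5 → Fin 5 → Fin 5) i) := by decide
  refine card_le_mul_of_relabel _ hp fun f hf ↦ ?_
  simp only [mem_filter, mem_labelledCopies_graphC5] at hf ⊢
  obtain ⟨hf, h⟩ := hf
  simp only [fun i ↦ hf.comp (hp i).injective, true_and]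
  have h0 := hB _ _ h.1
  have h1 := hB _ _ h.2.1
  have h2 := hB _ _ h.2.2.1
  have h3 := hB _ _ h.2.2.2.1
  have h4 := hB _ _ h.2.2.2.2
  simp [Fin.exists_fin_succ, h]
  grind

section EdgePairs

variable {V : Type*} [Fintype V] [DecidableEq V] {G : SimpleGraph V} [DecidableRel G.Adj]

/-- The labelled copies of `graphM` with first edge inside `B`, counted edge by edge. -/
theorem card_labelledCopies_graphM_filter (B : Finset V) :
    #((labelledCopies graphM G).filter fun f ↦ f 0 ∈ B ∧ f 1 ∈ B) =
      ∑ p ∈ G.interedges B B,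
        #(G.interedges (univ \ {p.1, p.2}) (univ \ {p.1, p.2})) * (Fintype.card V - 4) := by
  have hcard : #((G.interedges B B).sigma fun p ↦
      (G.interedges (univ \ {p.1, p.2}) (univ \ {p.1, p.2})).sigma fun q ↦
        (univ : Finset V) \ {p.1, p.2, q.1, q.2}) =
      ∑ p ∈ G.interedges B B,
        #(G.interedges (univ \ {p.1, p.2}) (univ \ {p.1, p.2})) * (Fintype.card V - 4) := by
    rw [card_sigma]
    refine sum_congr rfl fun p hp ↦ ?_
    rw [card_sigma]
    refine sum_const_nat fun q hq ↦ ?_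
    have hp' := ((SimpleGraph.mem_interedges_iff G).1 hp).2.2.ne
    simp only [SimpleGraph.mem_interedges_iff, mem_sdiff, mem_univ, true_and, mem_insert,
      mem_singleton, not_or] at hq
    have hq' := hq.2.2.ne
    rw [card_univ_sdiff, card_insert_of_notMem, card_insert_of_notMem, card_insert_of_notMem,
      card_singleton]
    all_goals grind
  rw [← hcard]
  refine card_nbij' (fun f ↦ ⟨(f 0, f 1), (f 2, f 3), f 4⟩)
    (fun x ↦ ![x.1.1, x.1.2, x.2.1.1, x.2.1.2, x.2.2]) ?_ ?_ ?_ ?_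
  · intro f hf
    simp only [coe_filter, Set.mem_ofPred_eq, mem_labelledCopies_graphM] at hf
    have h (i j) : f i = f j ↔ i = j := hf.1.1.eq_iff
    simp [SimpleGraph.mem_interedges_iff, h, hf]
  · rintro ⟨⟨a, b⟩, ⟨c, d⟩, z⟩ h
    simp only [coe_sigma, Set.mem_sigma_iff, mem_coe, SimpleGraph.mem_interedges_iff, mem_sdiff,
      mem_univ, true_and, mem_insert, mem_singleton, not_or] at h
    have hab := h.1.2.2.ne
    have hcd := h.2.1.2.2.ne
    simp only [coe_filter, Set.mem_ofPred_eq, mem_labelledCopies_graphM]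
    refine ⟨⟨?_, h.1.2.2, h.2.1.2.2⟩, h.1.1, h.1.2.1⟩
    intro i j hij
    fin_cases i <;> fin_cases j <;> first | rfl | (simp at hij; grind)
  · intro f _
    ext i; fin_cases i <;> rfl
  · rintro ⟨⟨a, b⟩, ⟨c, d⟩, z⟩ _
    rfl

/-- Mantel's bound on the vertices that remain, from the stability inequality by dropping its second
term. -/
theorem card_interedges_compl_edge_le (hG : ∀ a b c, G.Adj a b → G.Adj b c → ¬ G.Adj a c)
    {u v : V} (huv : u ≠ v) : #(G.interedges (univ \ {u, v}) (univ \ {u, v})) ≤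
      2 * ((Fintype.card V - 2) / 2 * ((Fintype.card V - 1) / 2)) := by
  obtain ⟨B, -, -, h⟩ := exists_card_interedges_add_le hG (univ \ {u, v})
  rw [card_univ_sdiff, card_pair huv] at h
  have h2 : 2 ≤ Fintype.card V := by
    rw [← card_pair huv]; exact card_le_univ _
  rw [show Fintype.card V - 2 + 1 = Fintype.card V - 1 by lia] at h
  lia

theorem card_labelledCopies_graphM_filter_le
    (hG : ∀ a b c, G.Adj a b → G.Adj b c → ¬ G.Adj a c) (B : Finset V) :
    #((labelledCopies graphM G).filter fun f ↦ f 0 ∈ B ∧ f 1 ∈ B) ≤ #(G.interedges B B) *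
      (2 * ((Fintype.card V - 2) / 2 * ((Fintype.card V - 1) / 2)) * (Fintype.card V - 4)) := by
  rw [card_labelledCopies_graphM_filter]
  refine sum_le_card_nsmul _ _ _ fun p hp ↦ ?_
  gcongr
  exact card_interedges_compl_edge_le hG ((SimpleGraph.mem_interedges_iff G).1 hp).2.2.ne

/-- In a triangle-free graph, an edge `uv`, a further edge and a further vertex extend to at most
one pentagon through `uv`. -/
theorem four_mul_card_labelledCopies_graphC5_filter_le
    (hG : ∀ a b c, G.Adj a b → G.Adj b c → ¬ G.Adj a c) (B : Finset V) :
    4 * #((labelledCopies graphC5 G).filter fun f ↦ f 0 ∈ B ∧ f 1 ∈ B) ≤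
      #((labelledCopies graphM G).filter fun f ↦ f 0 ∈ B ∧ f 1 ∈ B) := by
  -- These are the four 5-cycles on the five positions that use both edges 01 and 23. Two of them
  -- together always close a triangle.
  have hp : ∀ i, Function.Bijective ((![![0, 1, 2, 3, 4], ![0, 1, 3, 2, 4], ![0, 1, 4, 2, 3],
    ![0, 1, 4, 3, 2]] : Fin 4 → Fin 5 → Fin 5) i) := by decide
  refine mul_card_le_of_relabel _ hp ?_ ?_
  · intro i f hf
    simp only [mem_filter, mem_labelledCopies_graphC5, mem_labelledCopies_graphM] at hf ⊢
    refine ⟨⟨hf.1.1.of_comp_right (hp i).surjective, ?_⟩, ?_⟩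
    · have h23 := G.adj_comm (f 2) (f 3)
      fin_cases i <;> simp at hf <;> tauto
    · fin_cases i <;> simp at hf <;> tauto
  · intro i j f hi hj
    simp only [mem_filter, mem_labelledCopies_graphC5] at hi hj
    have := fun a b c h1 h2 ↦ hG (f a) (f b) (f c) h1 h2
    have := fun a b ↦ G.adj_comm (f a) (f b)
    fin_cases i <;> fin_cases j <;> simp at hi hj ⊢ <;> grind

/-- An upper bound, eight-fold, on the number of copies of `graphM` and `graphC5`. -/
theorem eight_mul_copyCount_graphM_add_graphC5_le
    (hG : ∀ a b c, G.Adj a b → G.Adj b c → ¬ G.Adj a c) :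
    8 * (G.copyCount graphM + G.copyCount graphC5) ≤
      2 * (Fintype.card V / 2 * ((Fintype.card V + 1) / 2)) *
      (2 * ((Fintype.card V - 2) / 2 * ((Fintype.card V - 1) / 2)) * (Fintype.card V - 4)) := by
  obtain ⟨B, -, hB, hle⟩ := exists_card_interedges_add_le hG univ
  have h1 := card_labelledCopies_graphM_filter_le hG univ
  have h2 := card_labelledCopies_graphM_filter_le hG B
  have h3 := four_mul_card_labelledCopies_graphC5_filter_le hG B
  have h4 := card_labelledCopies_graphC5_le fun x y h ↦ hB x (mem_univ _) y (mem_univ _) h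
  simp only [mem_univ, and_self, filter_true] at h1
  rw [card_labelledCopies_graphM] at h1
  rw [card_labelledCopies_graphC5] at h4
  rw [card_univ] at hle
  refine le_trans ?_ (Nat.mul_le_mul_right _ hle)
  rw [add_mul]
  lia

end EdgePairs

/-! ### The Turán graph attains the bound -/

theorem card_filter_even_fin (n : ℕ) :
    #((univ : Finset (Fin n)).filter fun i : Fin n ↦ (i : ℕ) % 2 = 0) = (n + 1) / 2 := by
  have h (m : ℕ) : #((range m).filter fun i ↦ i % 2 = 0) = (m + 1) / 2 := by
    induction m with
    | zero => rfl
    | succ k ih =>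
      rw [range_add_one, filter_insert]
      split_ifs
      · rw [card_insert_of_notMem (by simp), ih]; lia
      · rw [ih]; lia
  rw [← h n, ← card_map Fin.valEmbedding]
  congr 1; ext i
  simp only [mem_map, mem_filter, mem_univ, true_and, Fin.valEmbedding_apply, mem_range]
  exact ⟨fun ⟨a, h, e⟩ ↦ e ▸ ⟨a.2, h⟩, fun ⟨h, h'⟩ ↦ ⟨⟨i, h⟩, h', rfl⟩⟩

theorem card_interedges_turanGraph_two {n : ℕ} (S : Finset (Fin n)) :
    #((SimpleGraph.turanGraph n 2).interedges S S) =
      2 * (#(S.filter fun i : Fin n ↦ (i : ℕ) % 2 = 0) * #(S.filter fun i : Fin n ↦ ¬ (i : ℕ) % 2 = 0)) := by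
  rw [two_mul]
  nth_rw 2 [mul_comm]
  rw [← card_product, ← card_product, ← card_union_of_disjoint]
  · congr 1; ext ⟨u, v⟩
    simp only [SimpleGraph.mem_interedges_iff, SimpleGraph.turanGraph_adj, mem_union, mem_product,
      mem_filter]
    grind
  · rw [disjoint_left]
    simp only [mem_product, mem_filter]
    grind

/-- Both estimates behind the upper bound are equalities here: the edge count is Mantel's, and
deleting the ends of an edge takes one vertex from each class, leaving a balanced complete bipartite
graph on `n - 2` vertices. -/
theorem eight_mul_copyCount_graphM_turanGraph (n : ℕ) :
    8 * (SimpleGraph.turanGraph n 2).copyCount graphM = 2 * (n / 2 * ((n + 1) / 2)) *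
      (2 * ((n - 2) / 2 * ((n - 1) / 2)) * (n - 4)) := by
  have heven := card_filter_even_fin n
  have hodd : #((univ : Finset (Fin n)).filter fun i : Fin n ↦ ¬ (i : ℕ) % 2 = 0) = n / 2 := by
    have := card_filter_add_card_filter_not (s := (univ : Finset (Fin n)))
      fun i : Fin n ↦ (i : ℕ) % 2 = 0
    rw [heven, card_univ, Fintype.card_fin] at this
    lia
  have h := card_labelledCopies_graphM_filter (G := SimpleGraph.turanGraph n 2) univ
  simp only [mem_univ, and_self, filter_true] at h
  rw [← card_labelledCopies_graphM, h, Fintype.card_fin]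
  have htot := card_interedges_turanGraph_two (univ : Finset (Fin n))
  rw [heven, hodd, mul_comm ((n + 1) / 2)] at htot
  rw [← htot]
  refine sum_const_nat fun p hp ↦ ?_
  congr 1
  rw [card_interedges_turanGraph_two]
  obtain ⟨u, v⟩ := p
  have huv : (u : ℕ) % 2 ≠ v % 2 := ((SimpleGraph.mem_interedges_iff _).1 hp).2.2
  have aux {w x : Fin n} (P : Fin n → Prop) [DecidablePred P] (hw : P w) (hx : ¬ P x) :
      #((univ \ {w, x}).filter P) = #((univ : Finset (Fin n)).filter P) - 1 := by
    rw [← card_erase_of_mem (a := w) (by simpa using hw)]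
    congr 1; ext y
    simp only [mem_filter, mem_sdiff, mem_univ, true_and, mem_insert, mem_singleton, mem_erase]
    grind
  wlog hu : (u : ℕ) % 2 = 0 generalizing u v
  · rw [pair_comm]
    refine this v u ?_ huv.symm (by lia)
    rw [SimpleGraph.mem_interedges_iff] at hp ⊢
    exact ⟨hp.2.1, hp.1, hp.2.2.symm⟩
  · have hv : ¬ (v : ℕ) % 2 = 0 := by lia
    rw [aux (fun i : Fin n ↦ (i : ℕ) % 2 = 0) hu hv, pair_comm,
      aux (fun i : Fin n ↦ ¬ (i : ℕ) % 2 = 0) hv (not_not.2 hu), heven, hodd,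
      mul_comm ((n + 1) / 2 - 1), show n / 2 - 1 = (n - 2) / 2 by lia, show (n + 1) / 2 - 1 = (n - 1) / 2 by lia]

/-! ### Conclusion -/

theorem not_adj_of_top_free {V : Type*} {G : SimpleGraph V}
    (hG : (⊤ : SimpleGraph (Fin 3)).Free G) (a b c : V) (hab : G.Adj a b) (hbc : G.Adj b c) :
    ¬ G.Adj a c := by
  intro hac
  classical
  have h : G.CliqueFree 3 := by simpa using SimpleGraph.cliqueFree_iff_top_free.2 hG
  exact h {a, b, c} (SimpleGraph.is3Clique_triple_iff.2 ⟨hab, hac, hbc⟩)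

theorem turanGraph_two_adj_iff {n : ℕ} (a b : Fin n) : (SimpleGraph.turanGraph n 2).Adj a b ↔
    decide ((a : ℕ) % 2 = 0) ≠ decide ((b : ℕ) % 2 = 0) := by
  rw [SimpleGraph.turanGraph_adj, ne_eq, ne_eq, decide_eq_decide]
  lia

theorem top_three_free_turanGraph_two (n : ℕ) :
    (⊤ : SimpleGraph (Fin 3)).Free (SimpleGraph.turanGraph n 2) := by
  rintro ⟨f⟩
  have h (i j : Fin 3) (hij : i ≠ j) := SimpleGraph.turanGraph_adj.1 (f.toHom.map_adj
    (show (⊤ : SimpleGraph (Fin 3)).Adj i j from hij))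
  have := h 0 1 (by decide)
  have := h 1 2 (by decide)
  have := h 0 2 (by decide)
  lia

theorem copyCount_graphM_add_graphC5_le {n : ℕ} {G : SimpleGraph (Fin n)}
    (hG : ∀ a b c, G.Adj a b → G.Adj b c → ¬ G.Adj a c) :
    G.copyCount graphM + G.copyCount graphC5 ≤ (SimpleGraph.turanGraph n 2).copyCount graphM := by
  classical
  have h := eight_mul_copyCount_graphM_add_graphC5_le hG
  rw [Fintype.card_fin, ← eight_mul_copyCount_graphM_turanGraph] at h
  lia

/-- The case of `graphM` transfers to the others, which are bounded through `graphM` in `G` and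
reach that bound in the Turán graph. -/
theorem copyCount_add_copyCount_graphC5_le {n : ℕ} {G : SimpleGraph (Fin n)}
    (hG : ∀ a b c, G.Adj a b → G.Adj b c → ¬ G.Adj a c) {H : SimpleGraph (Fin 5)}
    (hH : H = graphM ∨ H = graphM' ∨ H = graphC4' ∨ H = graphP5 ∨ H = graphK23) :
    G.copyCount H + G.copyCount graphC5 ≤ (SimpleGraph.turanGraph n 2).copyCount H := by
  have hM := copyCount_graphM_add_graphC5_le hG
  have hT := turanGraph_two_adj_iff (n := n)
  rcases hH with rfl | rfl | rfl | rfl | rfl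
  · exact hM
  · have h1 := copyCount_graphM'_le hG
    have h2 := copyCount_graphM_le_graphM' hT
    lia
  · have h1 := copyCount_graphC4'_le hG
    have h2 := copyCount_graphM_le_graphC4' hT
    lia
  · have h1 := copyCount_graphP5_le hG
    have h2 := copyCount_graphM_le_graphP5 hT
    lia
  -- Of the six pentagon terms needed, five come from `h1` and the sixth from `hM`.
  · have h1 := six_mul_copyCount_graphK23_add_le hG
    have h2 := copyCount_graphM_le_graphK23 hT
    lia

theorem mainTheorem12 (k : ℕ) (hk : 2 ≤ k) (T : Fin k → SimpleGraph (Fin 5))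
    (hT : ∀ i, T i = graphM ∨ T i = graphM' ∨ T i = graphC4' ∨ T i = graphP5 ∨
      T i = graphK23 ∨ T i = graphC5)
    (hC5 : ∀ i j, T i = graphC5 → T j = graphC5 → i = j) (n : ℕ) :
    genEx n T (⊤ : SimpleGraph (Fin 3)) = totalCopies T (SimpleGraph.turanGraph n 2) := by
  classical
  refine le_antisymm (Finset.sup_le fun G hG ↦ ?_)
    (Finset.le_sup (f := fun G ↦ totalCopies T G)
      (by simpa using top_three_free_turanGraph_two n))
  have hfree := not_adj_of_top_free (mem_filter.1 hG).2
  have hpair (i) (hi : T i ≠ graphC5) :=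
    copyCount_add_copyCount_graphC5_le hfree (H := T i) (by have := hT i; tauto)
  unfold totalCopies
  -- If the pentagon occurs, its count is paired with one other entry `j`, whose slack absorbs it;
  -- the remaining entries are compared termwise. Without it, all entries are compared termwise.
  by_cases h : ∃ i, T i = graphC5
  · obtain ⟨i, hi⟩ := h
    have : Nontrivial (Fin k) := Fin.nontrivial_iff_two_le.2 hk
    obtain ⟨j, hji⟩ := exists_ne i
    have hne (l) (hl : l ≠ i) : T l ≠ graphC5 := fun h ↦ hl (hC5 l i h hi)
    have hj : j ∈ univ.erase i := by simpa using hji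
    rw [← add_sum_erase _ _ (mem_univ i), ← add_sum_erase _ _ (mem_univ i),
      ← add_sum_erase _ _ hj, ← add_sum_erase _ _ hj, hi]
    have h1 := hpair j (hne j hji)
    have h2 : ∑ l ∈ (univ.erase i).erase j, G.copyCount (T l) ≤
        ∑ l ∈ (univ.erase i).erase j, (SimpleGraph.turanGraph n 2).copyCount (T l) :=
      sum_le_sum fun l hl ↦ (Nat.le_add_right _ _).trans
        (hpair l (hne l (mem_erase.1 (mem_erase.1 hl).2).1))
    lia
  · push Not at h
    exact sum_le_sum fun l _ ↦ (Nat.le_add_right _ _).trans (hpair l (h l))
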